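/- Let $p$ be an odd prime, $q$ a power of $p$, $\mathbb F_q$ the finite field with $q$ elements, and let $k\ge 0$ be an integer. For $n\ge 1$ let $$D_{n,k}(a,x)=\sum_{i=0}^{\lfloor n/2\rfloor}\frac{n-ki}{n-i}\binom{n-i}{i}(-x)^i a^{n-2i}$$ (the coefficients $\frac{n-ki}{n-i}\binom{n-i}{i}$ are integers, read in $\mathbb F_q$), and $D_{0,k}(a,x)=2-k$, be the $n$-th reversed Dickson polynomial of the $(k+1)$-th kind. Put $\mathcal D_n=\sum_{a\in\mathbb F_q}D_{n,k}(1,a)\in\mathbb F_q$. In $\mathbb F_q[z]$ set $$B(z)=\bigl(2-k+(k-1)z\bigr)\bigl(-1-(z-z^q)^{q-1}\bigr)$$ and $$R(z)=(1+z^{q-1}-z^q)\sum_{i=1}^{q^2-1}z^i-\Bigl(z^{2(q-1)}+\sum_{m=1}^{q-1}(z-1)^{q-1-m}z^{2m}\bigl(\tfrac14\bigr)^m\Bigr)B(z),$$ and let $c_j$ be the coefficient of $z^j$ in $R(z)$. Then $R(z)=\sum_{i=1}^{q^2+q-1}c_iz^i$, and the following identities hold in $\mathbb F_q$: 1. $\mathcal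 D_j=-c_j+\dfrac{k(j-1)+2}{2^j}$ for $1\le j\le q-1$; 2. $\mathcal D_q=c_1-c_q+\dfrac{2-k}{2^q}$; 3. $\mathcal D_{lq+j}=\mathcal D_{(l-1)q+j}-\mathcal D_{(l-1)q+j+1}-c_{lq+j}+\dfrac{(kj+2)(1-2^q+2^{q-1})+k(2^q-1)}{2^{lq+j}}$ for $1\le l\le q-2$ and $1\le j\le q-1$; 4. $\mathcal D_{lq}=\mathcal D_{(l-1)q}-\mathcal D_{(l-1)q+1}-c_{lq}+\dfrac{(k-2)(2^q-1)+2^q}{2^{lq}}$ for $2\le l\le q-2$; 5. $\mathcal D_{q^2-q+j}=\displaystyle\sum_{i=j}^{q-1}c_{q^2+i}+\dfrac{k(j-1)+2}{2^{q^2-q+j}}$ for $0\le j\le q-1$. -/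

import Mathlib

open Polynomial

/-- The integer `(n - k i) / (n - i) * binom (n - i) i`, for `0 < n` and `i ≤ n / 2`.
The division of integers is exact, see `rdCoeff_cast`. -/
def rdCoeff (n k i : ℕ) : ℤ :=
  (((n : ℤ) - k * i) * ((n - i).choose i : ℤ)) / ((n : ℤ) - i)

theorem rdCoeff_dvd (n k i : ℕ) (hn : 0 < n) (hi : i ≤ n / 2) :
    ((n : ℤ) - i) ∣ ((n : ℤ) - k * i) * ((n - i).choose i : ℤ) := by
  obtain ⟨m, rfl⟩ : ∃ m, n = m + 1 + i := ⟨n - i - 1, by omega⟩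
  rcases i with _ | i
  · simp
  · have h := Nat.add_one_mul_choose_eq m i
    have h' : ((m : ℤ) + 1) * (m.choose i : ℤ) = ((m + 1).choose (i + 1) : ℤ) * (i + 1) := by
      exact_mod_cast h
    have e : m + 1 + (i + 1) - (i + 1) = m + 1 := by omega
    rw [e]
    refine ⟨((m + 1).choose (i + 1) : ℤ) - (k - 1) * (m.choose i : ℤ), ?_⟩
    push_cast
    linear_combination ((k : ℤ) - 1) * h'

theorem rdCoeff_cast (n k i : ℕ) (hn : 0 < n) (hi : i ≤ n / 2) :
    (rdCoeff n k i : ℚ) = ((n : ℚ) - k * i) / ((n : ℚ) - i) * ((n - i).choose i : ℚ) := by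
  have hne : ((n : ℤ) - i) ≠ 0 := by omega
  have hne' : (((n : ℤ) - i : ℤ) : ℚ) ≠ 0 := by exact_mod_cast hne
  rw [rdCoeff, Int.cast_div (rdCoeff_dvd n k i hn hi) hne']
  push_cast
  ring

/-- The `n`-th reversed Dickson polynomial of the `(k+1)`-th kind `D_{n,k}(a, x)`, as a polynomial
in `x` with parameter `a`. -/
noncomputable def reversedDickson {F : Type*} [CommRing F] (n k : ℕ) (a : F) : F[X] :=
  if n = 0 then C (2 - (k : F))
  else ∑ i ∈ Finset.range (n / 2 + 1), C ((rdCoeff n k i : ℤ) : F) * (-X) ^ i * C (a ^ (n - 2 * i))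

/-- The sum of `D_{n,k}(1, a)` over all `a` in the finite field `F`. -/
noncomputable def dicksonSum (F : Type*) [Field F] [Fintype F] (n k : ℕ) : F :=
  ∑ a : F, (reversedDickson n k (1 : F)).eval a

/-- `∑ b_j z^j = (2 - k + (k - 1) z) (-1 - (z - z^q)^(q-1))`. -/
noncomputable def bPoly (F : Type*) [Field F] (q k : ℕ) : F[X] :=
  (C (2 - (k : F)) + C ((k : F) - 1) * X) * (-1 - (X - X ^ q) ^ (q - 1))

/-- The polynomial `∑ c_i z^i`, that is
`(1 + z^(q-1) - z^q) ∑_{i=1}^{q^2-1} z^i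
  - (z^(2(q-1)) + ∑_{m=1}^{q-1} (z-1)^(q-1-m) z^(2m) (1/4)^m) ∑ b_j z^j`. -/
noncomputable def cPoly (F : Type*) [Field F] (q k : ℕ) : F[X] :=
  (1 + X ^ (q - 1) - X ^ q) * (∑ i ∈ Finset.Icc 1 (q ^ 2 - 1), X ^ i)
    - (X ^ (2 * (q - 1))
        + ∑ m ∈ Finset.Icc 1 (q - 1), (X - 1) ^ (q - 1 - m) * X ^ (2 * m) * C ((1 / 4 : F) ^ m))
      * bPoly F q k

/-- The coefficient `c_j`. -/
noncomputable def cCoeff (F : Type*) [Field F] (q k j : ℕ) : F :=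
  (cPoly F q k).coeff j

/-!
Reversed Dickson polynomials are Dickson polynomials with the roles of variable and parameter
exchanged, so `D_{n,k}(1, a)` is a linear recurrent sequence in `n` with generating function
`(2 - k + (k - 1) z) / (1 - z + a z ^ 2)`. If `a ≠ 1/4`, the characteristic roots are distinct and
lie in the field with `q ^ 2` elements, so the sequence repeats after `q ^ 2 - 1` steps and its part
in degrees `1` to `q ^ 2 - 1` is `1 - z ^ (q ^ 2 - 1)` times the generating function without its
constant term. (For `a = 0` only the constant term fails to repeat.)

The denominators have product `(1 - z ^ (q - 1)) (1 + z ^ (q - 1) - z ^ q)`, and the cofactor of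
each is a geometric sum, a polynomial in `a` of degree `q - 1`; by the power sums over a finite
field, all cofactors together add up to `-z ^ (2 (q - 1))`. Summing over `a ≠ 1/4` therefore gives
`R(z) = (z ^ q - z ^ (q - 1) - 1) ∑ (∑_{a ≠ 1/4} D_{n,k}(1, a)) z ^ n`. The identities compare
coefficients and add the term `a = 1/4`, where the double root `1/2` gives
`D_{n,k}(1, 1/4) = (k (n - 1) + 2) / 2 ^ n`.
-/

section Dickson

variable {R : Type*} [CommRing R]

theorem choose_add_two_sub_succ (n i : ℕ) :
    (n + 2 - (i + 1)).choose (i + 1) = (n - i).choose i + (n - i).choose (i + 1) := by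
  rcases le_or_gt i n with hi | hi
  · rw [show n + 2 - (i + 1) = n - i + 1 by omega, Nat.choose_succ_succ]
  · rw [Nat.choose_eq_zero_of_lt (by omega), Nat.choose_eq_zero_of_lt (by omega),
      Nat.choose_eq_zero_of_lt (by omega)]

theorem dickson_two_eq_sum_range (x : R) (n : ℕ) {t : ℕ} (ht : n / 2 < t) :
    dickson 2 x n =
      ∑ i ∈ Finset.range t, C ((n - i).choose i : R) * (-C x) ^ i * X ^ (n - 2 * i) := by
  induction n using Nat.twoStepInduction generalizing t with
  | zero =>
    rw [Finset.sum_eq_single_of_mem 0 (Finset.mem_range.2 (by omega))]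
    · simp only [dickson_zero, Nat.cast_ofNat, tsub_self, Nat.choose_self, Nat.cast_one, map_one,
        pow_zero, mul_one, mul_zero]
      norm_num
    · intro i _ hi
      simp [Nat.choose_eq_zero_of_lt (Nat.pos_of_ne_zero hi)]
  | one =>
    rw [Finset.sum_eq_single_of_mem 0 (Finset.mem_range.2 (by omega))]
    · simp
    · intro i _ hi
      simp [Nat.choose_eq_zero_of_lt (show 1 - i < i by omega)]
  | more n ih₀ ih₁ =>
    obtain ⟨t, rfl⟩ : ∃ s, t = s + 1 := ⟨t - 1, by omega⟩
    have shift (i : ℕ) : C ((n - i).choose (i + 1) : R) * (X : R[X]) ^ (n - 2 * i) =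
        C ((n - i).choose (i + 1) : R) * (X * X ^ (n + 1 - 2 * (i + 1))) := by
      rcases lt_or_ge (2 * i) n with hi | hi
      · rw [← pow_succ', show n + 1 - 2 * (i + 1) + 1 = n - 2 * i by omega]
      · simp [Nat.choose_eq_zero_of_lt (show n - i < i + 1 by omega)]
    rw [dickson_add_two, ih₀ (t := t) (by omega), ih₁ (t := t + 1) (by omega),
      Finset.sum_range_succ', Finset.sum_range_succ', mul_add, Finset.mul_sum, Finset.mul_sum,
      add_sub_right_comm, ← Finset.sum_sub_distrib]
    congr 1
    · refine Finset.sum_congr rfl fun i _ => ?_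
      rw [choose_add_two_sub_succ, Nat.add_sub_add_right,
        show n + 2 - 2 * (i + 1) = n - 2 * i by omega, Nat.cast_add, C_add]
      linear_combination -(-C x) ^ (i + 1) * shift i
    · simp [pow_succ']

theorem dickson_succ_eq (k : ℕ) (x : R) (n : ℕ) :
    dickson k x (n + 1) =
      (3 - (k : R[X])) * dickson 2 x (n + 1) + ((k : R[X]) - 2) * X * dickson 2 x n := by
  induction n using Nat.twoStepInduction with
  | zero => simp only [zero_add, dickson_one, dickson_zero]; push_cast; ring
  | one => simp only [Nat.reduceAdd, dickson_two, dickson_one]; push_cast; ring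
  | more n ih₀ ih₁ =>
    rw [dickson_add_two, ih₀, ih₁, dickson_add_two 2 x (n + 1), dickson_add_two 2 x n]
    ring

theorem rdCoeff_succ (n k i : ℕ) (hi : i ≤ (n + 1) / 2) :
    rdCoeff (n + 1) k i =
      (2 - k) * ((n + 1 - i).choose i : ℤ) + (k - 1) * ((n - i).choose i : ℤ) := by
  refine Int.ediv_eq_of_eq_mul_right (by omega) ?_
  have h : ((n - i).choose i : ℤ) * (n - i + 1) =
      ((n + 1 - i).choose i : ℤ) * (n + 1 - 2 * i) := by
    rw [show n + 1 - i = n - i + 1 by omega]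
    have := Nat.choose_mul_succ_eq (n - i) i
    zify [show i ≤ n by omega, show i ≤ n - i + 1 by omega] at this
    linear_combination this
  push_cast
  linear_combination (1 - (k : ℤ)) * h

/- Mathlib's Dickson polynomials put the variable where the reversed ones have the parameter `a`,
and their first two values show that kind `k + 1` in both numberings means the same. -/
theorem eval_reversedDickson (n k : ℕ) (a x : R) :
    (reversedDickson n k a).eval x = (dickson (k + 1) x n).eval a := by
  rcases n with _ | n
  · simp only [reversedDickson, ↓reduceIte, map_sub, map_natCast, eval_sub, eval_natCast,
      dickson_zero, Nat.cast_add, Nat.cast_one, eval_ofNat, eval_add, eval_one, map_ofNat]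
    ring
  · rw [dickson_succ_eq, dickson_two_eq_sum_range x (n + 1) (Nat.lt_succ_self _),
      dickson_two_eq_sum_range x n (t := (n + 1) / 2 + 1) (by omega), reversedDickson,
      if_neg n.succ_ne_zero]
    have shift (i : ℕ) : ((n - i).choose i : R) * a ^ (n + 1 - 2 * i) =
        ((n - i).choose i : R) * (a * a ^ (n - 2 * i)) := by
      rcases le_or_gt (2 * i) n with hi | hi
      · rw [← pow_succ', show n + 1 - 2 * i = n - 2 * i + 1 by omega]
      · rw [Nat.choose_eq_zero_of_lt (by omega), Nat.cast_zero, zero_mul, zero_mul]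
    simp only [eval_add, eval_sub, eval_mul, eval_pow, eval_neg, eval_finsetSum, eval_C, eval_X,
      eval_natCast, eval_ofNat, Finset.mul_sum, ← Finset.sum_add_distrib]
    refine Finset.sum_congr rfl fun i hi => ?_
    rw [rdCoeff_succ n k i (Nat.lt_succ_iff.1 (Finset.mem_range.1 hi))]
    push_cast
    linear_combination ((k : R) - 1) * (-x) ^ i * shift i

theorem eval_dickson_add_two (k : ℕ) (a b : R) (n : ℕ) :
    (dickson k a (n + 2)).eval b =
      b * (dickson k a (n + 1)).eval b - a * (dickson k a n).eval b := by
  simp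

theorem eval_dickson_add_mul (k : ℕ) (x y : R) (n : ℕ) :
    (x - y) * (dickson k (x * y) n).eval (x + y) =
      (x + (k - 2) * y) * x ^ n - (y + (k - 2) * x) * y ^ n := by
  induction n using Nat.twoStepInduction with
  | zero => simp only [dickson_zero, eval_sub, eval_ofNat, eval_natCast]; ring
  | one => simp only [dickson_one, eval_X]; ring
  | more n ih₀ ih₁ =>
    rw [eval_dickson_add_two]
    linear_combination (x + y) * ih₁ - x * y * ih₀

theorem eval_dickson_sq (k : ℕ) (b : R) (n : ℕ) :
    (dickson k (b ^ 2) n).eval (2 * b) = ((k - 1) * (n - 1) + 2) * b ^ n := by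
  induction n using Nat.twoStepInduction with
  | zero => simp only [dickson_zero, eval_sub, eval_ofNat, eval_natCast, Nat.cast_zero]; ring
  | one => simp
  | more n ih₀ ih₁ =>
    rw [eval_dickson_add_two, ih₀, ih₁]
    push_cast
    ring

theorem eval_dickson_add_of_pow_eq_one [IsDomain R] (k : ℕ) {x y : R} (hxy : x ≠ y) {N : ℕ}
    (hx : x ^ N = 1) (hy : y ^ N = 1) (n : ℕ) :
    (dickson k (x * y) (n + N)).eval (x + y) = (dickson k (x * y) n).eval (x + y) := by
  apply mul_left_cancel₀ (sub_ne_zero.2 hxy)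
  rw [eval_dickson_add_mul, eval_dickson_add_mul, pow_add, pow_add, hx, hy, mul_one, mul_one]

theorem eval_dickson_zero_succ (k : ℕ) (b : R) (n : ℕ) :
    (dickson k 0 (n + 1)).eval b = b ^ (n + 1) := by
  induction n with
  | zero => simp
  | succ n ih => rw [eval_dickson_add_two, ih]; ring

end Dickson

section RecurrenceSums

variable {R : Type*} [CommRing R] {a b : R} {u : ℕ → R}

theorem mul_sum_Icc_of_recurrence (hu : ∀ n, u (n + 2) = b * u (n + 1) - a * u n) (N : ℕ) :
    (1 - C b * X + C a * X ^ 2) * ∑ n ∈ Finset.Icc 1 N, C (u n) * X ^ n =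
      C (u 1) * X - C (a * u 0) * X ^ 2 - C (u (N + 1)) * X ^ (N + 1)
        + C (a * u N) * X ^ (N + 2) := by
  induction N with
  | zero => simp
  | succ N ih =>
    rw [Finset.sum_Icc_succ_top N.succ_pos, mul_add, ih, hu]
    simp only [C_sub, C_mul]
    ring

theorem mul_sum_Icc_of_recurrence_of_periodic
    (hu : ∀ n, u (n + 2) = b * u (n + 1) - a * u n) {N : ℕ}
    (h₀ : a * u N = a * u 0) (h₁ : u (N + 1) = u 1) :
    (1 - C b * X + C a * X ^ 2) * ∑ n ∈ Finset.Icc 1 N, C (u n) * X ^ n =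
      (1 - X ^ N) * (C (u 1) * X - C (a * u 0) * X ^ 2) := by
  rw [mul_sum_Icc_of_recurrence hu, h₀, h₁]
  ring

end RecurrenceSums

section FiniteField

variable {F : Type*} [Field F] [Fintype F] {q : ℕ}

theorem sub_pow_card {A : Type*} [CommRing A] [Algebra F A] (hq : Fintype.card F = q) (x y : A) :
    (x - y) ^ q = x ^ q - y ^ q := by
  subst hq
  exact map_sub (FiniteField.frobeniusAlgHom F A) x y

theorem sum_pow_card_sub_one (F : Type*) [Field F] [Fintype F] :
    ∑ a : F, a ^ (Fintype.card F - 1) = -1 := by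
  classical
  have hpow (a : F) : a ^ (Fintype.card F - 1) = 1 - if a = 0 then 1 else 0 := by
    split_ifs with ha
    · rw [ha, zero_pow (Nat.sub_ne_zero_of_lt Fintype.one_lt_card), sub_self]
    · rw [FiniteField.pow_card_sub_one_eq_one a ha, sub_zero]
  simp [hpow]

theorem pow_card_sq_eq_self {K : Type*} [CommRing K] [IsDomain K] [Algebra F K] {a b : F} {x y : K}
    (hq : Fintype.card F = q) (hadd : x + y = algebraMap F K b) (hmul : x * y = algebraMap F K a) :
    x ^ q ^ 2 = x := by
  subst hq
  let φ := FiniteField.frobeniusAlgHom F K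
  have hadd' : φ x + φ y = x + y := by rw [← map_add, hadd, AlgHom.commutes]
  have hmul' : φ x * φ y = x * y := by rw [← map_mul, hmul, AlgHom.commutes]
  suffices φ (φ x) = x by rwa [sq, pow_mul]
  have hroot : (φ x - x) * (φ x - y) = 0 := by linear_combination φ x * hadd' - hmul'
  rcases mul_eq_zero.1 hroot with h | h
  · rw [sub_eq_zero.1 h, sub_eq_zero.1 h]
  · have hx : φ x = y := sub_eq_zero.1 h
    rw [hx]
    linear_combination hadd' - hx

theorem exists_add_eq_mul_eq {K : Type*} [Field K] [IsAlgClosed K] (s p : K) :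
    ∃ x y : K, x + y = s ∧ x * y = p := by
  obtain ⟨x, hx⟩ := IsAlgClosed.exists_root (C 1 * X ^ 2 + C (-s) * X + C p) (by
    rw [degree_quadratic one_ne_zero]; decide)
  refine ⟨x, s - x, add_sub_cancel x s, ?_⟩
  simp only [IsRoot, eval_add, eval_mul, eval_C, eval_pow, eval_X] at hx
  linear_combination -hx

theorem eval_dickson_add_card_sq_sub_one (hq : Fintype.card F = q) (k : ℕ) {a b : F} (ha : a ≠ 0)
    (hdisc : 4 * a ≠ b ^ 2) (n : ℕ) :
    (dickson k a (n + (q ^ 2 - 1))).eval b = (dickson k a n).eval b := by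
  let K := AlgebraicClosure F
  obtain ⟨x, y, hadd, hmul⟩ :=
    exists_add_eq_mul_eq (algebraMap F K b) (algebraMap F K a)
  have hinj := (algebraMap F K).injective
  have hxy : x ≠ y := by
    rintro rfl
    apply hdisc
    apply hinj
    rw [map_mul, map_ofNat, map_pow, ← hadd, ← hmul]
    ring
  have hxy₀ : x * y ≠ 0 := hmul ▸ (_root_.map_ne_zero _).2 ha
  have hq₁ : 1 ≤ q ^ 2 := Nat.one_le_pow _ _ (hq ▸ Fintype.card_pos)
  have period {z : K} (hz : z ≠ 0) (h : z ^ q ^ 2 = z) : z ^ (q ^ 2 - 1) = 1 := by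
    rw [pow_sub₀ _ hz hq₁, h, pow_one, mul_inv_cancel₀ hz]
  have hx := period (left_ne_zero_of_mul hxy₀) (pow_card_sq_eq_self hq hadd hmul)
  have hy := period (right_ne_zero_of_mul hxy₀)
    (pow_card_sq_eq_self hq ((add_comm y x).trans hadd) ((mul_comm y x).trans hmul))
  apply hinj
  rw [← eval_map_apply, ← eval_map_apply, map_dickson, map_dickson, ← hadd, ← hmul]
  exact eval_dickson_add_of_pow_eq_one k hxy hx hy n

end FiniteField

section GeneratingFunction

variable {R : Type*} [CommRing R]

/-- The numerator of the generating function
`∑ D_{n,k}(1, a) z^n = (2 - k + (k - 1) z) / (1 - z + a z^2)`; it does not depend on `a`. -/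
noncomputable def dicksonNumer (R : Type*) [CommRing R] (k : ℕ) : R[X] :=
  C (2 - (k : R)) + C ((k : R) - 1) * X

/-- The denominator of the generating function of `D_{n,k}(1, a)`; it does not depend on `k`. -/
noncomputable def dicksonDenom (a : R) : R[X] :=
  1 - X + C a * X ^ 2

/-- The product of `dicksonDenom a` over the elements `a` of a field with `q` elements, in the
closed form `w ^ q - w z ^ (2 (q - 1))`, where `w = 1 - z`. -/
noncomputable def dicksonDenomProd (R : Type*) [CommRing R] (q : ℕ) : R[X] :=
  1 - X ^ q - (1 - X) * X ^ (2 * (q - 1))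

/-- The quotient of `dicksonDenomProd` by `dicksonDenom a`, see `dicksonDenom_mul_cofactor`. -/
noncomputable def dicksonCofactor (q : ℕ) (a : R) : R[X] :=
  ∑ i ∈ Finset.range q, (C a * X ^ 2) ^ i * (X - 1) ^ (q - 1 - i) - X ^ (2 * (q - 1))

/-- The part of the generating function of `D_{n,k}(1, a)` in degrees `1` to `q ^ 2 - 1`. -/
noncomputable def dicksonTruncGen (q k : ℕ) (a : R) : R[X] :=
  ∑ n ∈ Finset.Icc 1 (q ^ 2 - 1), C ((dickson (k + 1) a n).eval 1) * X ^ n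

theorem dicksonDenomProd_eq_mul {q : ℕ} (hq : q ≠ 0) :
    dicksonDenomProd R q = (1 - X ^ (q - 1)) * (1 + X ^ (q - 1) - X ^ q) := by
  obtain ⟨r, rfl⟩ := Nat.exists_eq_succ_of_ne_zero hq
  rw [dicksonDenomProd, Nat.succ_eq_add_one, Nat.add_sub_cancel]
  ring

theorem sum_Icc_eq_dicksonCofactor {q : ℕ} (hq : q ≠ 0) (a : R) :
    ∑ m ∈ Finset.Icc 1 (q - 1), (X - 1) ^ (q - 1 - m) * X ^ (2 * m) * C (a ^ m) =
      dicksonCofactor q a + X ^ (2 * (q - 1)) - (X - 1) ^ (q - 1) := by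
  rw [dicksonCofactor, sub_add_cancel, Finset.range_eq_Ico,
    Finset.sum_eq_sum_Ico_succ_bot (Nat.pos_of_ne_zero hq), pow_zero, one_mul, Nat.sub_zero,
    add_sub_cancel_left, zero_add, ← Finset.Ico_add_one_right_eq_Icc,
    Nat.sub_add_cancel (Nat.one_le_iff_ne_zero.2 hq)]
  refine Finset.sum_congr rfl fun m _ => ?_
  rw [mul_pow, ← C_pow, ← pow_mul]
  ring

variable {F : Type*} [Field F] [Fintype F] {q : ℕ}

theorem dicksonDenom_mul_cofactor (hq : Fintype.card F = q) (a : F) :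
    dicksonDenom a * dicksonCofactor q a = dicksonDenomProd F q := by
  have hgeom := (Commute.all (C a * X ^ 2) (X - 1)).mul_geom_sum₂ q
  have hq₀ : q ≠ 0 := hq ▸ Fintype.card_ne_zero
  have ha : a ^ q = a := hq ▸ FiniteField.pow_card a
  have hX : (X ^ 2 : F[X]) ^ q = X ^ 2 * X ^ (2 * (q - 1)) := by
    rw [← pow_mul, ← pow_add, show 2 + 2 * (q - 1) = 2 * q by omega]
  rw [mul_pow, ← C_pow, ha, hX, sub_pow_card hq, one_pow] at hgeom
  rw [dicksonDenom, dicksonCofactor, dicksonDenomProd]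
  linear_combination hgeom

theorem sum_dicksonCofactor (hq : Fintype.card F = q) :
    ∑ a : F, dicksonCofactor q a = -X ^ (2 * (q - 1)) := by
  subst hq
  have hpos : 0 < Fintype.card F := Fintype.card_pos
  have hterm (i : ℕ) : ∑ a : F, (C a * X ^ 2) ^ i * (X - 1 : F[X]) ^ (Fintype.card F - 1 - i) =
      C (∑ a : F, a ^ i) * X ^ (2 * i) * (X - 1) ^ (Fintype.card F - 1 - i) := by
    simp only [mul_pow, ← C_pow, ← pow_mul, map_sum, Finset.sum_mul]
  simp only [dicksonCofactor]
  rw [Finset.sum_sub_distrib, Finset.sum_comm, Finset.sum_const, Finset.card_univ, nsmul_eq_mul,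
    ← C_eq_natCast, FiniteField.cast_card_eq_zero, C_0, zero_mul, sub_zero,
    Finset.sum_eq_single_of_mem (Fintype.card F - 1) (Finset.mem_range.2 (by omega))]
  · rw [hterm, sum_pow_card_sub_one, Nat.sub_self, pow_zero, mul_one, C_neg, C_1, neg_one_mul]
  · intro i hi hne
    rw [Finset.mem_range] at hi
    rw [hterm, FiniteField.sum_pow_lt_card_sub_one F i (by omega), C_0, zero_mul, zero_mul]

theorem dicksonDenom_mul_truncGen (hq : Fintype.card F = q) (k : ℕ) {a : F} (ha : 4 * a ≠ 1) :
    dicksonDenom a * dicksonTruncGen q k a =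
      (1 - X ^ (q ^ 2 - 1)) * (dicksonNumer F k - C (2 - (k : F)) * dicksonDenom a) := by
  have hperiod : a * (dickson (k + 1) a (q ^ 2 - 1)).eval 1 = a * (dickson (k + 1) a 0).eval 1 ∧
      (dickson (k + 1) a (q ^ 2 - 1 + 1)).eval 1 = (dickson (k + 1) a 1).eval 1 := by
    rcases eq_or_ne a 0 with rfl | ha₀
    · simp [eval_dickson_zero_succ]
    · have := eval_dickson_add_card_sq_sub_one hq (k + 1) ha₀ (b := 1) (by simpa using ha)
      exact ⟨by simpa using congrArg (a * ·) (this 0), by rw [add_comm (q ^ 2 - 1), this 1]⟩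
  have h := mul_sum_Icc_of_recurrence_of_periodic (u := fun n => (dickson (k + 1) a n).eval 1)
    (eval_dickson_add_two (k + 1) a 1) hperiod.1 hperiod.2
  simp only [C_1, one_mul, dickson_zero, dickson_one, eval_sub, eval_ofNat, eval_natCast,
    eval_X] at h
  rw [dicksonDenom, dicksonTruncGen, h, dicksonNumer]
  simp only [map_sub, map_mul, map_natCast, map_ofNat, map_one]
  push_cast
  ring

/- As `dicksonDenomProd` is the common denominator, this evaluates the sum of
`dicksonNumer / dicksonDenom a` over `a ≠ c`. -/
theorem dicksonDenomProd_mul_sum_truncGen [DecidableEq F] (hq : Fintype.card F = q) (k : ℕ) {c : F}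
    (hc : 4 * c = 1) :
    dicksonDenomProd F q * ∑ a ∈ Finset.univ.erase c, dicksonTruncGen q k a =
      (1 - X ^ (q ^ 2 - 1)) * (C (2 - (k : F)) * dicksonDenomProd F q
        - dicksonNumer F k * (dicksonCofactor q c + X ^ (2 * (q - 1)))) := by
  have h4 : (4 : F) ≠ 0 := left_ne_zero_of_mul_eq_one hc
  have hterm (a : F) (ha : a ∈ Finset.univ.erase c) :
      dicksonDenomProd F q * dicksonTruncGen q k a =
        (1 - X ^ (q ^ 2 - 1)) *
          (dicksonNumer F k * dicksonCofactor q a - C (2 - (k : F)) * dicksonDenomProd F q) := by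
    have ha4 : 4 * a ≠ 1 := fun h =>
      Finset.ne_of_mem_erase ha (mul_left_cancel₀ h4 (h.trans hc.symm))
    have hgen := dicksonDenom_mul_truncGen hq k ha4
    rw [← dicksonDenom_mul_cofactor hq a]
    linear_combination dicksonCofactor q a * hgen
  have hcard : ((Fintype.card F - 1 : ℕ) : F[X]) = -1 := by
    rw [Nat.cast_pred Fintype.card_pos, ← C_eq_natCast, FiniteField.cast_card_eq_zero, C_0,
      zero_sub]
  rw [Finset.mul_sum, Finset.sum_congr rfl hterm, ← Finset.mul_sum, Finset.sum_sub_distrib,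
    ← Finset.mul_sum, Finset.sum_erase_eq_sub (Finset.mem_univ c), sum_dicksonCofactor hq,
    Finset.sum_const, Finset.card_erase_of_mem (Finset.mem_univ c), Finset.card_univ,
    nsmul_eq_mul, hcard]
  ring

end GeneratingFunction

section Factorization

variable {F : Type*} [Field F] [Fintype F] {q : ℕ}

theorem one_sub_X_pow_mul_bPoly (hq : Fintype.card F = q) (k : ℕ) :
    (1 - X ^ (q - 1)) * bPoly F q k = -(dicksonNumer F k * (1 - X ^ (q ^ 2 - 1))) := by
  have hq₀ : q ≠ 0 := hq ▸ Fintype.card_ne_zero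
  have hfrob := sub_pow_card hq (X : F[X]) (X ^ q)
  rw [← pow_mul, ← sq, ← pow_sub_one_mul hq₀ (X - X ^ q), ← pow_sub_one_mul hq₀ X,
    ← pow_sub_one_mul (pow_ne_zero 2 hq₀) X] at hfrob
  apply mul_left_cancel₀ (X_ne_zero (R := F))
  rw [bPoly, dicksonNumer, ← pow_sub_one_mul hq₀ X]
  linear_combination -(C (2 - (k : F)) + C ((k : F) - 1) * X) * hfrob

theorem one_sub_X_pow_mul_cPoly (hq : Fintype.card F = q) (k : ℕ) :
    (1 - X ^ (q - 1)) * cPoly F q k =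
      (1 - X ^ (q ^ 2 - 1)) * (dicksonNumer F k * (dicksonCofactor q (1 / 4) + X ^ (2 * (q - 1)))
        - C (2 - (k : F)) * dicksonDenomProd F q) := by
  have hq₀ : q ≠ 0 := hq ▸ Fintype.card_ne_zero
  have hgeom : (1 - X : F[X]) * ∑ i ∈ Finset.Icc 1 (q ^ 2 - 1), X ^ i =
      X * (1 - X ^ (q ^ 2 - 1)) := by
    rw [← Finset.Ico_add_one_right_eq_Icc, mul_comm, geom_sum_Ico_mul_neg _ (by omega)]
    ring
  have hB := one_sub_X_pow_mul_bPoly hq k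
  have hfrob : (X - 1 : F[X]) ^ (q - 1) * (X - 1) = X ^ q - 1 := by
    rw [pow_sub_one_mul hq₀, sub_pow_card hq, one_pow]
  have hnumer : dicksonNumer F k + C (2 - (k : F)) * (X - 1) = X := by
    simp only [dicksonNumer, map_sub, map_natCast, map_ofNat, map_one]
    ring
  have hprod := dicksonDenomProd_eq_mul (R := F) hq₀
  have hprod' : dicksonDenomProd F q = 1 - X ^ q - (1 - X) * X ^ (2 * (q - 1)) := rfl
  -- The factor `X - 1` completes both the geometric sum and `(X - 1) ^ (q - 1)`.
  apply mul_left_cancel₀ (X_sub_C_ne_zero (1 : F))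
  rw [cPoly, sum_Icc_eq_dicksonCofactor hq₀, C_1]
  generalize ∑ i ∈ Finset.Icc 1 (q ^ 2 - 1), (X : F[X]) ^ i = G at hgeom ⊢
  linear_combination -(X - 1) * G * hprod - dicksonDenomProd F q * hgeom
    - (X - 1) * (2 * X ^ (2 * (q - 1)) + dicksonCofactor q (1 / 4) - (X - 1) ^ (q - 1)) * hB
    - (1 - X ^ (q ^ 2 - 1)) * (dicksonNumer F k * (hfrob + hprod') - dicksonDenomProd F q * hnumer)

theorem cPoly_eq_mul_sum_truncGen [DecidableEq F] (hq : Fintype.card F = q) (h2 : (2 : F) ≠ 0)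
    (k : ℕ) :
    cPoly F q k = (X ^ q - X ^ (q - 1) - 1) *
      ∑ a ∈ Finset.univ.erase (1 / 4 : F), dicksonTruncGen q k a := by
  have hq₁ : q ≠ 1 := hq ▸ Fintype.one_lt_card.ne'
  have h4 : (4 : F) * (1 / 4) = 1 :=
    mul_one_div_cancel (by rw [← two_add_two_eq_four, ← two_mul]; exact mul_ne_zero h2 h2)
  have hne : (1 - X ^ (q - 1) : F[X]) ≠ 0 := by
    rw [← neg_sub, neg_ne_zero]
    exact X_pow_sub_C_ne_zero (by have := hq ▸ Fintype.card_pos (α := F); omega) 1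
  have hsum := dicksonDenomProd_mul_sum_truncGen hq k h4
  rw [dicksonDenomProd_eq_mul (hq ▸ Fintype.card_ne_zero)] at hsum
  apply mul_left_cancel₀ hne
  rw [one_sub_X_pow_mul_cPoly hq, dicksonDenomProd_eq_mul (hq ▸ Fintype.card_ne_zero)]
  linear_combination hsum

end Factorization

section Coefficients

/-- The polynomial whose coefficients in degrees `1` to `q ^ 2 - 1` are the sums of `D_{n,k}(1, a)`
over `a ≠ 1/4`; the subtracted fraction is `D_{n,k}(1, 1/4)`. -/
noncomputable def dicksonSumGen (F : Type*) [Field F] [Fintype F] (q k : ℕ) : F[X] :=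
  ∑ n ∈ Finset.Icc 1 (q ^ 2 - 1),
    C (dicksonSum F n k - ((k : F) * ((n : F) - 1) + 2) / 2 ^ n) * X ^ n

variable {F : Type*} [Field F] [Fintype F] {q : ℕ}

theorem sum_truncGen_eq_dicksonSumGen [DecidableEq F] (h2 : (2 : F) ≠ 0) (q k : ℕ) :
    ∑ a ∈ Finset.univ.erase (1 / 4 : F), dicksonTruncGen q k a = dicksonSumGen F q k := by
  have hquarter (n : ℕ) : (dickson (k + 1) (1 / 4 : F) n).eval 1 =
      ((k : F) * ((n : F) - 1) + 2) / 2 ^ n := by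
    have h := eval_dickson_sq (k + 1) (1 / 2 : F) n
    rw [mul_one_div_cancel h2, div_pow, one_pow, show (2 : F) ^ 2 = 4 by norm_num] at h
    rw [h, one_div_pow, ← div_eq_mul_one_div]
    push_cast
    ring
  simp only [dicksonTruncGen, dicksonSumGen, dicksonSum, eval_reversedDickson, ← hquarter,
    ← Finset.sum_erase_eq_sub (Finset.mem_univ (1 / 4 : F)), map_sum, Finset.sum_mul]
  exact Finset.sum_comm

theorem cPoly_eq_mul_dicksonSumGen (hq : Fintype.card F = q) (h2 : (2 : F) ≠ 0) (k : ℕ) :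
    cPoly F q k = (X ^ q - X ^ (q - 1) - 1) * dicksonSumGen F q k := by
  classical rw [cPoly_eq_mul_sum_truncGen hq h2, sum_truncGen_eq_dicksonSumGen h2]

theorem coeff_dicksonSumGen (q k n : ℕ) :
    (dicksonSumGen F q k).coeff n = if n ∈ Finset.Icc 1 (q ^ 2 - 1) then
      dicksonSum F n k - ((k : F) * ((n : F) - 1) + 2) / 2 ^ n else 0 := by
  simp only [dicksonSumGen, finsetSum_coeff, coeff_C_mul_X_pow, Finset.sum_ite_eq]

theorem coeff_dicksonSumGen_zero (q k : ℕ) : (dicksonSumGen F q k).coeff 0 = 0 := by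
  simp [coeff_dicksonSumGen]

theorem coeff_dicksonSumGen_of_sq_le {n : ℕ} (hq : q ≠ 0) (k : ℕ) (hn : q ^ 2 ≤ n) :
    (dicksonSumGen F q k).coeff n = 0 := by
  have := pow_pos (Nat.pos_of_ne_zero hq) 2
  rw [coeff_dicksonSumGen, if_neg (by rw [Finset.mem_Icc]; omega)]

theorem dicksonSum_eq_coeff_add {n : ℕ} (q k : ℕ) (hn : n ≠ 0) (hnq : n < q ^ 2) :
    dicksonSum F n k = (dicksonSumGen F q k).coeff n + ((k : F) * ((n : F) - 1) + 2) / 2 ^ n := by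
  rw [coeff_dicksonSumGen, if_pos (by rw [Finset.mem_Icc]; omega), sub_add_cancel]

theorem cCoeff_of_lt (hq : Fintype.card F = q) (h2 : (2 : F) ≠ 0) (k : ℕ) {j : ℕ} (hj : j < q) :
    cCoeff F q k j = -(dicksonSumGen F q k).coeff j := by
  have hmid : (X ^ (q - 1) * dicksonSumGen F q k).coeff j = 0 := by
    rw [coeff_X_pow_mul']
    split_ifs with h
    · rw [show j - (q - 1) = 0 by omega, coeff_dicksonSumGen_zero]
    · rfl
  rw [cCoeff, cPoly_eq_mul_dicksonSumGen hq h2, sub_mul, sub_mul, one_mul, coeff_sub, coeff_sub,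
    hmid, coeff_X_pow_mul', if_neg hj.not_ge, sub_zero, zero_sub]

theorem cCoeff_add_card (hq : Fintype.card F = q) (h2 : (2 : F) ≠ 0) (k n : ℕ) :
    cCoeff F q k (n + q) = (dicksonSumGen F q k).coeff n - (dicksonSumGen F q k).coeff (n + 1)
      - (dicksonSumGen F q k).coeff (n + q) := by
  have hpos : 0 < q := hq ▸ Fintype.card_pos
  rw [cCoeff, cPoly_eq_mul_dicksonSumGen hq h2, sub_mul, sub_mul, one_mul, coeff_sub, coeff_sub,
    coeff_X_pow_mul, show n + q = n + 1 + (q - 1) by omega, coeff_X_pow_mul]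

theorem cPoly_eq_sum_Icc (hq : Fintype.card F = q) (h2 : (2 : F) ≠ 0) (k : ℕ) :
    cPoly F q k = ∑ i ∈ Finset.Icc 1 (q ^ 2 + q - 1), C (cCoeff F q k i) * X ^ i := by
  have hpos : 0 < q := hq ▸ Fintype.card_pos
  ext j
  simp only [finsetSum_coeff, coeff_C_mul_X_pow, Finset.sum_ite_eq]
  split_ifs with hj
  · rfl
  · change cCoeff F q k j = 0
    rw [Finset.mem_Icc, not_and_or] at hj
    rcases hj with hj | hj
    · rw [show j = 0 by omega, cCoeff_of_lt hq h2 k hpos, coeff_dicksonSumGen_zero, neg_zero]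
    · obtain ⟨n, rfl⟩ : ∃ n, j = n + q := ⟨j - q, by omega⟩
      have hvanish {m : ℕ} (hm : q ^ 2 ≤ m) := coeff_dicksonSumGen_of_sq_le (F := F) hpos.ne' k hm
      rw [cCoeff_add_card hq h2, hvanish (by omega), hvanish (by omega), hvanish (by omega)]
      ring

theorem dicksonSum_of_lt (hq : Fintype.card F = q) (h2 : (2 : F) ≠ 0) (k : ℕ) {j : ℕ} (hj : j ≠ 0)
    (hjq : j < q) :
    dicksonSum F j k = -cCoeff F q k j + ((k : F) * ((j : F) - 1) + 2) / 2 ^ j := by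
  rw [dicksonSum_eq_coeff_add q k hj (hjq.trans_le (Nat.le_self_pow two_ne_zero q)),
    cCoeff_of_lt hq h2 k hjq, neg_neg]

theorem dicksonSum_card (hq : Fintype.card F = q) (h2 : (2 : F) ≠ 0) (k : ℕ) :
    dicksonSum F q k = cCoeff F q k 1 - cCoeff F q k q + (2 - (k : F)) / 2 ^ q := by
  have hlt : 1 < q := hq ▸ Fintype.one_lt_card
  have hq₀ : (q : F) = 0 := hq ▸ FiniteField.cast_card_eq_zero F
  have hc := cCoeff_add_card hq h2 k 0
  simp only [zero_add, coeff_dicksonSumGen_zero] at hc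
  rw [dicksonSum_eq_coeff_add q k (by omega) (lt_self_pow₀ hlt one_lt_two),
    cCoeff_of_lt hq h2 k hlt, hc, hq₀]
  ring

theorem dicksonSum_add_card (hq : Fintype.card F = q) (h2 : (2 : F) ≠ 0) (k : ℕ) {n : ℕ}
    (hn : n ≠ 0) (hnq : n + q < q ^ 2) :
    dicksonSum F (n + q) k =
      dicksonSum F n k - dicksonSum F (n + 1) k - cCoeff F q k (n + q) + k / 2 ^ (n + q) := by
  have hlt : 1 < q := hq ▸ Fintype.one_lt_card
  have hq₀ : (q : F) = 0 := hq ▸ FiniteField.cast_card_eq_zero F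
  have h2q : (2 : F) ^ q = 2 := hq ▸ FiniteField.pow_card 2
  rw [dicksonSum_eq_coeff_add q k (by omega) hnq, dicksonSum_eq_coeff_add q k hn (by omega),
    dicksonSum_eq_coeff_add q k n.succ_ne_zero (by omega), cCoeff_add_card hq h2, pow_add, h2q,
    pow_succ, Nat.cast_add, Nat.cast_succ, hq₀]
  field_simp
  ring

theorem dicksonSum_sq_sub_card_add (hq : Fintype.card F = q) (h2 : (2 : F) ≠ 0) (k : ℕ) {j : ℕ}
    (hj : j < q) :
    dicksonSum F (q ^ 2 - q + j) k = (∑ i ∈ Finset.Icc j (q - 1), cCoeff F q k (q ^ 2 + i))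
      + ((k : F) * ((j : F) - 1) + 2) / 2 ^ (q ^ 2 - q + j) := by
  have hlt : q < q ^ 2 := lt_self_pow₀ (hq ▸ Fintype.one_lt_card) one_lt_two
  let e (i : ℕ) : F := (dicksonSumGen F q k).coeff (q ^ 2 - q + i)
  have hterm (i : ℕ) : cCoeff F q k (q ^ 2 + i) = -(e (i + 1) - e i) := by
    rw [show q ^ 2 + i = q ^ 2 - q + i + q by omega, cCoeff_add_card hq h2,
      coeff_dicksonSumGen_of_sq_le (n := q ^ 2 - q + i + q) (by omega) k (by omega)]
    simp only [e, add_assoc]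
    ring
  have hsum : ∑ i ∈ Finset.Icc j (q - 1), cCoeff F q k (q ^ 2 + i) = e j := by
    have hend : e q = 0 := coeff_dicksonSumGen_of_sq_le (by omega) k (by omega)
    rw [← Finset.Ico_add_one_right_eq_Icc, Nat.sub_add_cancel (by omega)]
    simp only [hterm]
    rw [Finset.sum_neg_distrib, Finset.sum_Ico_sub e hj.le, hend, zero_sub, neg_neg]
  have hcast : ((q ^ 2 - q + j : ℕ) : F) = j := by
    have hq₀ : (q : F) = 0 := hq ▸ FiniteField.cast_card_eq_zero F
    simp [Nat.cast_sub hlt.le, hq₀]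
  rw [dicksonSum_eq_coeff_add q k (by omega) (by omega), hcast, hsum]

end Coefficients

theorem theoremT4p2 (F : Type*) [Field F] [Fintype F] (hF : ringChar F ≠ 2)
    (q : ℕ) (hq : Fintype.card F = q) (k : ℕ) :
    -- the `c_i` with `1 ≤ i ≤ q^2 + q - 1` are all the coefficients of the right-hand side
    (cPoly F q k = ∑ i ∈ Finset.Icc 1 (q ^ 2 + q - 1), C (cCoeff F q k i) * X ^ i) ∧
    (∀ j : ℕ, 1 ≤ j → j ≤ q - 1 →
      dicksonSum F j k = -cCoeff F q k j + ((k : F) * ((j : F) - 1) + 2) / 2 ^ j) ∧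
    (dicksonSum F q k = cCoeff F q k 1 - cCoeff F q k q + (2 - (k : F)) / 2 ^ q) ∧
    (∀ l j : ℕ, 1 ≤ l → l ≤ q - 2 → 1 ≤ j → j ≤ q - 1 →
      dicksonSum F (l * q + j) k =
        dicksonSum F ((l - 1) * q + j) k - dicksonSum F ((l - 1) * q + j + 1) k
          - cCoeff F q k (l * q + j)
          + (((k : F) * (j : F) + 2) * (1 - 2 ^ q + 2 ^ (q - 1)) + (k : F) * (2 ^ q - 1))
              / 2 ^ (l * q + j)) ∧
    (∀ l : ℕ, 2 ≤ l → l ≤ q - 2 →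
      dicksonSum F (l * q) k =
        dicksonSum F ((l - 1) * q) k - dicksonSum F ((l - 1) * q + 1) k - cCoeff F q k (l * q)
          + (((k : F) - 2) * (2 ^ q - 1) + 2 ^ q) / 2 ^ (l * q)) ∧
    (∀ j : ℕ, j ≤ q - 1 →
      dicksonSum F (q ^ 2 - q + j) k =
        (∑ i ∈ Finset.Icc j (q - 1), cCoeff F q k (q ^ 2 + i))
          + ((k : F) * ((j : F) - 1) + 2) / 2 ^ (q ^ 2 - q + j)) := by
  have hpos : 0 < q := hq ▸ Fintype.card_pos
  have h2 : (2 : F) ≠ 0 := Ring.two_ne_zero hF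
  have h2q : (2 : F) ^ q = 2 := hq ▸ FiniteField.pow_card 2
  have h2q' : (2 : F) ^ (q - 1) = 1 := hq ▸ FiniteField.pow_card_sub_one_eq_one 2 h2
  refine ⟨cPoly_eq_sum_Icc hq h2 k, fun j hj₁ hj₂ => dicksonSum_of_lt hq h2 k (by omega) (by omega),
    dicksonSum_card hq h2 k, fun l j hl₁ hl₂ hj₁ hj₂ => ?_, fun l hl₁ hl₂ => ?_,
    fun j hj => dicksonSum_sq_sub_card_add hq h2 k (by omega)⟩
  · obtain ⟨m, rfl⟩ := Nat.exists_eq_add_of_le' hl₁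
    have hm : (m + 3) * q ≤ q ^ 2 := sq q ▸ Nat.mul_le_mul_right q (by omega)
    rw [Nat.add_sub_cancel, show (m + 1) * q + j = m * q + j + q by ring,
      dicksonSum_add_card hq h2 k (by omega) (by linarith [show j < q by omega]), h2q, h2q']
    ring
  · obtain ⟨m, rfl⟩ := Nat.exists_eq_add_of_le' hl₁
    have hm : (m + 4) * q ≤ q ^ 2 := sq q ▸ Nat.mul_le_mul_right q (by omega)
    rw [show m + 2 - 1 = m + 1 by omega, show (m + 2) * q = (m + 1) * q + q by ring,
      dicksonSum_add_card hq h2 k (by positivity) (by linarith), h2q]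
    ring
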